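/- Let $\Theta$ be the linear cellular automaton (CA) with state set $(\mathbb{Z}/2)^2$ given by the matrix $$\Theta=\begin{pmatrix}0&1\\1&u^{-1}+1+u\end{pmatrix}$$ over $\mathbb{Z}/2[u,u^{-1}]$, where $u$ acts on configurations as the shift $\sigma_1$, with $\sigma_z(c)_x=c_{x-z}$. Say that a CA $F$ simulates a CA $G$ if there are integers $m_1,m_2,t_1,t_2\ge 1$ and $z_1,z_2\in\mathbb{Z}$ and an injection from the state set of $b_{m_1}\circ\sigma_{z_1}\circ G^{t_1}\circ b_{m_1}^{-1}$ to that of $b_{m_2}\circ\sigma_{z_2}\circ F^{t_2}\circ b_{m_2}^{-1}$ whose uniform extension to configurations intertwines these two global rules, where $b_m(c)(z)=(c(mz),\dots,c(mz+m-1))$. For a CA $F$ with state set $A$ and an integer $p\ge 2$, let $X_p(F)$ be the set of $(x,y)\in\mathbb{R}\times[0,\infty)$ such that for some $k\in\mathbb{N}$ and all large enough $n$, the numbers $a=xp^n$ and $b=yp^n$ are integers and, for every configuration $c\in A^{\mathbb{Z}}$, if $c[q]$ denotes $c$ with the state of cell $0$ replaced by $q$: the map $q\mapsto F^b(c[q])_a$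 is a bijection of $A$, and the map $q\mapsto F^b(c[q])_z$ is constant for every integer $z\ne a$ with $|z-a|\le p^{n-k}$. Then: 1. $\Theta$ is reversible, and it simulates its mirror $\mathrm{mir}\circ\Theta\circ\mathrm{mir}$, where $\mathrm{mir}(c)_z=c_{-z}$, its inverse $\Theta^{-1}$, and its dual $\mathrm{mir}\circ\Theta^{-1}\circ\mathrm{mir}$. 2. $\Theta$ does not simulate the identity CA over any finite state set with at least two elements. 3. The closure of $X_2(\Theta)$ in $\mathbb{R}^2$ is not contained in a line. -/

import Mathlib

open scoped LaurentPolynomial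

/-- A one-dimensional cellular automaton with state set `A`, given by its global rule on
configurations `ℤ → A`: the new state of the cell `x` is obtained by applying a fixed local rule to
the states of the cells `x + i`, `i` in a finite neighbourhood. -/
@[ext]
structure CellularAutomaton (A : Type*) where
  /-- The global rule. -/
  toFun : (ℤ → A) → ℤ → A
  exists_local : ∃ (N : Finset ℤ) (f : (N → A) → A), ∀ c x, toFun c x = f fun i => c (x + i)

namespace CellularAutomaton

variable {A B : Type*}

/-- A map that commutes with translations and whose value at `0` depends only on the
states of finitely many cells is given by a local rule. -/
theorem exists_local_of_commute (G : (ℤ → A) → ℤ → A)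
    (hs : ∀ c x, G c x = G (fun i => c (x + i)) 0)
    (hN : ∃ N : Finset ℤ, ∀ c d : ℤ → A, (∀ i ∈ N, c i = d i) → G c 0 = G d 0) :
    ∃ (N : Finset ℤ) (f : (N → A) → A), ∀ c x, G c x = f fun i => c (x + i) := by
  classical
  rcases isEmpty_or_nonempty A with hA | ⟨⟨a⟩⟩
  · exact ⟨{0}, fun w => w ⟨0, by simp⟩, fun c => (hA.false (c 0)).elim⟩
  · obtain ⟨N, hN⟩ := hN
    refine ⟨N, fun w => G (fun i => if h : i ∈ N then w ⟨i, h⟩ else a) 0, fun c x => ?_⟩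
    rw [hs]
    apply hN
    intro i hi
    simp [hi]

theorem commute (F : CellularAutomaton A) (c : ℤ → A) (x y : ℤ) :
    F.toFun (fun i => c (x + i)) y = F.toFun c (x + y) := by
  obtain ⟨N, f, h⟩ := F.exists_local
  simp only [h, add_assoc]

theorem exists_finset (F : CellularAutomaton A) (S : Finset ℤ) :
    ∃ N : Finset ℤ, ∀ c d : ℤ → A, (∀ i ∈ N, c i = d i) →
      ∀ x ∈ S, F.toFun c x = F.toFun d x := by
  classical
  obtain ⟨N, f, h⟩ := F.exists_local
  refine ⟨S.biUnion fun x => N.image fun i => x + i, fun c d hcd x hx => ?_⟩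
  rw [h, h]
  congr 1
  funext i
  exact hcd _ (Finset.mem_biUnion.2 ⟨x, hx, Finset.mem_image_of_mem _ i.2⟩)

/-- The identity. -/
protected def id (A : Type*) : CellularAutomaton A where
  toFun c := c
  exists_local := exists_local_of_commute _ (by simp) ⟨{0}, by simp⟩

/-- The shift `σ_z`. -/
def shift (A : Type*) (z : ℤ) : CellularAutomaton A where
  toFun c x := c (x - z)
  exists_local := exists_local_of_commute _ (by intro c x; simp [sub_eq_add_neg])
    ⟨{-z}, by simp⟩

/-- The composition `F ∘ G`. -/
def comp (F G : CellularAutomaton A) : CellularAutomaton A where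
  toFun c := F.toFun (G.toFun c)
  exists_local := by
    refine exists_local_of_commute _ (fun c x => ?_) ?_
    · have : G.toFun (fun i => c (x + i)) = fun i => G.toFun c (x + i) :=
        funext fun y => G.commute c x y
      rw [this, F.commute, add_zero]
    · obtain ⟨N, hN⟩ := F.exists_finset {0}
      obtain ⟨N', hN'⟩ := G.exists_finset N
      exact ⟨N', fun c d h => hN _ _ (hN' c d h) 0 (by simp)⟩

/-- The iterate `F^t`. -/
def iterate (F : CellularAutomaton A) : ℕ → CellularAutomaton A
  | 0 => CellularAutomaton.id A
  | t + 1 => F.comp (F.iterate t)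

/-- The packing bijection `b_m` for `m ≥ 1`, with `(b_m c)(z) = (c(mz), …, c(mz + m - 1))`. -/
def pack (A : Type*) (m : ℕ) (hm : 0 < m) : (ℤ → A) ≃ (ℤ → Fin m → A) where
  toFun c z i := c (m * z + (i : ℕ))
  invFun d x := d (x / m) ⟨(x % m).toNat, by
    have h1 := Int.emod_nonneg x (b := m) (by omega)
    have h2 := Int.emod_lt_of_pos x (b := m) (by omega)
    omega⟩
  left_inv c := by
    funext x
    have h1 := Int.emod_nonneg x (b := m) (by omega)
    simp only [Int.toNat_of_nonneg h1, Int.mul_ediv_add_emod]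
  right_inv d := by
    funext z i
    have hi : ((i : ℕ) : ℤ) < m := by exact_mod_cast i.2
    have h1 : ((m : ℤ) * z + (i : ℕ)) / m = z := by
      rw [Int.mul_add_ediv_left _ _ (by omega), Int.ediv_eq_zero_of_lt (by omega) hi, add_zero]
    have h2 : ((m : ℤ) * z + (i : ℕ)) % m = (i : ℕ) := by
      rw [Int.mul_add_emod_self_left, Int.emod_eq_of_lt (by omega) hi]
    simp only [h1, h2, Int.toNat_natCast]

/-- The grouped automaton `b_m ∘ F ∘ b_m⁻¹`. -/
def group (F : CellularAutomaton A) (m : ℕ) (hm : 0 < m) : CellularAutomaton (Fin m → A) where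
  toFun d := pack A m hm (F.toFun ((pack A m hm).symm d))
  exists_local := by
    refine exists_local_of_commute _ (fun d x => ?_) ?_
    · have h : (pack A m hm).symm (fun i => d (x + i)) =
          fun y => (pack A m hm).symm d (m * x + y) := by
        rw [Equiv.symm_apply_eq]
        funext z i
        have := congrFun (congrFun ((pack A m hm).apply_symm_apply d) (x + z)) i
        rw [← this]
        simp only [pack, Equiv.coe_fn_mk, mul_add, add_assoc]
      rw [h]
      funext i
      simp only [pack, Equiv.coe_fn_mk, mul_zero, zero_add]
      exact (F.commute _ _ _).symm
    · classical
      obtain ⟨N, hN⟩ := F.exists_finset (Finset.univ.image fun i : Fin m => ((i : ℕ) : ℤ))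
      refine ⟨N.image fun x => x / (m : ℤ), fun c d h => ?_⟩
      funext i
      simp only [pack, Equiv.coe_fn_mk, mul_zero, zero_add]
      refine hN _ _ (fun x hx => ?_) _ (Finset.mem_image_of_mem _ (Finset.mem_univ i))
      simp only [Equiv.coe_fn_symm_mk]
      rw [h _ (Finset.mem_image_of_mem _ hx)]

/-- The rescaling of `F` with packing `m ≥ 1`, iteration `t` and shift `z`: its global rule is
`b_m ∘ σ_z ∘ F^t ∘ b_m⁻¹`. -/
def rescale (F : CellularAutomaton A) (m : ℕ) (hm : 0 < m) (t : ℕ) (z : ℤ) :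
    CellularAutomaton (Fin m → A) :=
  ((shift A z).comp (F.iterate t)).group m hm

/-- `F` is a sub-automaton of `G`: some injection of the state sets, extended uniformly to
configurations, intertwines the global rules. -/
def IsSubautomaton (F : CellularAutomaton A) (G : CellularAutomaton B) : Prop :=
  ∃ φ : A → B, Function.Injective φ ∧ ∀ c : ℤ → A, φ ∘ F.toFun c = G.toFun (φ ∘ c)

/-- `F` simulates `G`: some rescaling of `G` is a sub-automaton of some rescaling of `F`. -/
def Simulates (F : CellularAutomaton A) (G : CellularAutomaton B) : Prop :=
  ∃ (m₁ m₂ : ℕ) (hm₁ : 0 < m₁) (hm₂ : 0 < m₂) (t₁ t₂ : ℕ) (z₁ z₂ : ℤ),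
    0 < t₁ ∧ 0 < t₂ ∧ (G.rescale m₁ hm₁ t₁ z₁).IsSubautomaton (F.rescale m₂ hm₂ t₂ z₂)

/-- The mirror of `F`, namely `mir ∘ F ∘ mir` where `mir(c)_z = c_{-z}`. -/
def mirror (F : CellularAutomaton A) : CellularAutomaton A where
  toFun c x := F.toFun (fun z => c (-z)) (-x)
  exists_local := by
    refine exists_local_of_commute _ (fun c x => ?_) ?_
    · have := F.commute (fun z => c (-z)) (-x) 0
      simp only [neg_add_rev, neg_neg, add_zero] at this
      simp only [neg_zero, ← this]
      congr 1
      funext i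
      rw [add_comm]
    · classical
      obtain ⟨N, hN⟩ := F.exists_finset {0}
      refine ⟨N.image fun i => -i, fun c d h => ?_⟩
      exact hN _ _ (fun i hi => h _ (Finset.mem_image_of_mem _ hi)) _ (by simp)

/-- `F` is reversible: it has a two-sided inverse which is a cellular automaton. -/
def IsReversible (F : CellularAutomaton A) : Prop :=
  ∃ G : CellularAutomaton A,
    G.comp F = CellularAutomaton.id A ∧ F.comp G = CellularAutomaton.id A

/-- The inverse of a reversible automaton. -/
noncomputable def inverse (F : CellularAutomaton A) (h : F.IsReversible) : CellularAutomaton A :=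
  h.choose

/-- The dual `mir ∘ F⁻¹ ∘ mir` of a reversible automaton. -/
noncomputable def dual (F : CellularAutomaton A) (h : F.IsReversible) : CellularAutomaton A :=
  (F.inverse h).mirror

/-- The map `q ↦ (F^y (c with the state of the cell 0 replaced by q))_x`. -/
def influence (F : CellularAutomaton A) (y : ℕ) (x : ℤ) (c : ℤ → A) (q : A) : A :=
  (F.iterate y).toFun (Function.update c 0 q) x

/-- The property `(x, y, l, r)`: whatever the configuration, the state of the cell `0` at time `0`
acts bijectively on the cell `x` at time `y`, and does not influence the other cells of
`[x - l, x + r]` at time `y`. -/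
def IsConcentrated (F : CellularAutomaton A) (x : ℤ) (y l r : ℕ) : Prop :=
  (∀ c, Function.Bijective (F.influence y x c)) ∧
    ∀ (c : ℤ → A) (z : ℤ), x - l ≤ z → z ≤ x + r → z ≠ x →
      ∀ q q' : A, F.influence y z c q = F.influence y z c q'

/-- The set `X_p(F)` of the points `(x, y)` of `ℝ × [0, ∞)` such that, for some `k` and all large
enough `n`, the numbers `x p^n` and `y p^n` are integers and `F` has the property
`(x p^n, y p^n, p^(n-k), p^(n-k))`. Only `n ≥ k` matters, so `n - k` is a true subtraction. -/
def X (p : ℕ) (F : CellularAutomaton A) : Set (ℝ × ℝ) :=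
  {P | 0 ≤ P.2 ∧ ∃ k : ℕ, ∀ᶠ n : ℕ in Filter.atTop, ∃ (a : ℤ) (b : ℕ),
    (a : ℝ) = P.1 * (p : ℝ) ^ n ∧ (b : ℝ) = P.2 * (p : ℝ) ^ n ∧
      F.IsConcentrated a b (p ^ (n - k)) (p ^ (n - k))}

/-- The linear automaton over `R^d` of a matrix of Laurent polynomials in `u`, where the
indeterminate `u` acts as the shift `σ_1`. -/
def linear {R : Type*} [CommRing R] {d : ℕ} (M : Matrix (Fin d) (Fin d) R[T;T⁻¹]) :
    CellularAutomaton (Fin d → R) where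
  toFun c x i := ∑ j, (M i j).coeff.sum fun k a => a * c (x - k) j
  exists_local := by
    refine exists_local_of_commute _ (fun c x => ?_) ?_
    · simp [sub_eq_add_neg]
    · classical
      refine ⟨Finset.univ.biUnion fun i => Finset.univ.biUnion fun j =>
        (M i j).coeff.support.image fun k => 0 - k, fun c d h => ?_⟩
      funext i
      refine Finset.sum_congr rfl fun j _ => Finset.sum_congr rfl fun k hk => ?_
      have hcd : c (0 - k) = d (0 - k) := by
        apply h
        simp only [Finset.mem_biUnion, Finset.mem_univ, true_and]
        exact ⟨i, j, Finset.mem_image_of_mem _ hk⟩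
      change _ * c (0 - k) j = _ * d (0 - k) j
      rw [hcd]

/-- The automaton `Θ` over `(ℤ/2)^2`; in Mathlib's notation `T k` is the monomial `u^k`. -/
noncomputable def Theta : CellularAutomaton (Fin 2 → ZMod 2) :=
  linear !![0, 1; 1, LaurentPolynomial.T (-1) + 1 + LaurentPolynomial.T 1]

end CellularAutomaton

/-! Write s for `threeTerm` and M for `thetaMatrix`. The polynomial s is invariant under u ↦ u⁻¹, so
Θ is its own mirror; exchanging the two coordinates conjugates Θ to Θ⁻¹. This settles the positive
simulations.

If Θ simulated an identity, some Θ^t with t > 0 would act as a shift on all recoded configurations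
(`exists_iterate_recode`). By linearity, the difference of two that come from configurations
differing in one cell is a nonzero finitely supported V with M^t V = u^w V. As det M^t = 1, this
forces tr M^t = u^w + u^(-w). That is impossible (`thetaTrace_ne`): the degree gives |w| = t, the
coefficient of u^(t-1) is t mod 2, and even t descends to t/2 because tr M^(2n) = (tr M^n)².

By Cayley–Hamilton M² = sM + 1, so M^b = p + qM, and in characteristic 2 squaring gives M^(2b) = (p²
+ q²) + s q² M. Thus a gap around a monomial u^a in M^b doubles with b (`ConcentratedPow.two_mul`),
so one small gap puts (a, b) in X_2. The points (0,0), (0,3) and (3,7) arise in this way and are not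
collinear. -/

namespace CellularAutomaton

variable {A B : Type*}

/-! ### Powers of the matrix of Θ and their traces -/

section Algebra

open LaurentPolynomial Matrix

instance : CharP (ZMod 2)[T;T⁻¹] 2 :=
  charP_of_injective_algebraMap (FaithfulSMul.algebraMap_injective (ZMod 2) (ZMod 2)[T;T⁻¹]) 2

/-- The Laurent polynomial `u⁻¹ + 1 + u`. -/
noncomputable def threeTerm : (ZMod 2)[T;T⁻¹] := T (-1) + 1 + T 1

theorem coeff_one (z : ℤ) : (1 : (ZMod 2)[T;T⁻¹]).coeff z = if 0 = z then 1 else 0 := by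
  rw [← T_zero, T_apply]

theorem coeff_T_mul (k : ℤ) (f : (ZMod 2)[T;T⁻¹]) (z : ℤ) :
    (T k * f).coeff z = f.coeff (z - k) := by
  have := AddMonoidAlgebra.coeff_single_mul_apply f (1 : ZMod 2) k z
  rw [one_mul, neg_add_eq_sub] at this
  exact this

theorem coeff_threeTerm_mul (f : (ZMod 2)[T;T⁻¹]) (z : ℤ) :
    (threeTerm * f).coeff z = f.coeff (z + 1) + f.coeff z + f.coeff (z - 1) := by
  simp only [threeTerm, add_mul, one_mul, AddMonoidAlgebra.coeff_add, Finsupp.add_apply,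
    coeff_T_mul, sub_neg_eq_add]

theorem coeff_threeTerm (z : ℤ) :
    threeTerm.coeff z = (if -1 = z then 1 else 0) + (if 0 = z then 1 else 0) +
      if 1 = z then 1 else 0 := by
  simp only [threeTerm, AddMonoidAlgebra.coeff_add, Finsupp.add_apply, T_apply, coeff_one]

/-- Frobenius: over ℤ/2, f(u)² = f(u²). -/
theorem coeff_sq (f : (ZMod 2)[T;T⁻¹]) (z : ℤ) :
    (f ^ 2).coeff z = if Even z then f.coeff (z / 2) else 0 := by
  induction f using LaurentPolynomial.induction_on' with
  | add p q hp hq =>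
    rw [CharTwo.add_sq, AddMonoidAlgebra.coeff_add, Finsupp.add_apply, hp, hq]
    split_ifs <;> simp
  | C_mul_T n a =>
    have ha : a ^ 2 = a := by revert a; decide
    rw [mul_pow, ← map_pow, ha, T_pow, ← single_eq_C_mul_T, ← single_eq_C_mul_T,
      AddMonoidAlgebra.coeff_single, AddMonoidAlgebra.coeff_single, Finsupp.single_apply,
      Finsupp.single_apply]
    push_cast
    by_cases hz : Even z
    · obtain ⟨y, rfl⟩ := hz
      have : (y + y) / 2 = y := by omega
      simp only [this, Even.add_self, if_true]
      congr 1
      apply propext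
      constructor <;> intro h <;> omega
    · rw [if_neg hz, if_neg]
      rintro rfl
      exact hz (even_two_mul n)

theorem coeff_sq_two_mul (f : (ZMod 2)[T;T⁻¹]) (z : ℤ) :
    (f ^ 2).coeff (2 * z) = f.coeff z := by
  rw [coeff_sq, if_pos (even_two_mul z), Int.mul_ediv_cancel_left z (by norm_num)]

theorem sq_injective : Function.Injective fun f : (ZMod 2)[T;T⁻¹] => f ^ 2 := by
  intro f g h
  refine LaurentPolynomial.ext fun z => ?_
  rw [← coeff_sq_two_mul f, ← coeff_sq_two_mul g]
  exact congrArg (fun f : (ZMod 2)[T;T⁻¹] => f.coeff (2 * z)) h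

/-- The matrix of `Θ`. -/
noncomputable def thetaMatrix : Matrix (Fin 2) (Fin 2) (ZMod 2)[T;T⁻¹] :=
  !![0, 1; 1, threeTerm]

theorem thetaMatrix_sq : thetaMatrix ^ 2 = threeTerm • thetaMatrix + 1 := by
  ext i j : 2
  fin_cases i <;> fin_cases j <;> simp [thetaMatrix, pow_two, add_comm]

theorem det_thetaMatrix_pow (n : ℕ) : (thetaMatrix ^ n).det = 1 := by
  rw [det_pow, thetaMatrix, det_fin_two_of]
  simp [CharTwo.neg_eq]

/-- The trace of `Θ^n`. -/
noncomputable def thetaTrace (n : ℕ) : (ZMod 2)[T;T⁻¹] := (thetaMatrix ^ n).trace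

theorem thetaTrace_zero : thetaTrace 0 = 0 := by
  simp only [thetaTrace, pow_zero, trace_one, Fintype.card_fin]
  exact CharTwo.two_eq_zero

theorem thetaTrace_one : thetaTrace 1 = threeTerm := by
  simp [thetaTrace, thetaMatrix, trace_fin_two]

theorem thetaTrace_add_two (n : ℕ) :
    thetaTrace (n + 2) = threeTerm * thetaTrace (n + 1) + thetaTrace n := by
  simp only [thetaTrace]
  rw [pow_add, thetaMatrix_sq, mul_add, mul_smul_comm, ← pow_succ, mul_one, trace_add, trace_smul,
    smul_eq_mul]

/-- For a 2 × 2 matrix, tr(M²) = (tr M)² - 2 det M, and 2 = 0. -/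
theorem thetaTrace_two_mul (n : ℕ) : thetaTrace (2 * n) = thetaTrace n ^ 2 := by
  have h := det_thetaMatrix_pow n
  simp only [thetaTrace]
  rw [mul_comm, pow_mul]
  generalize thetaMatrix ^ n = M at h
  have h2 : (2 : (ZMod 2)[T;T⁻¹]) = 0 := CharTwo.two_eq_zero
  rw [pow_two, trace_fin_two, trace_fin_two, mul_apply, mul_apply, Fin.sum_univ_two,
    Fin.sum_univ_two]
  linear_combination (M 0 1 * M 1 0 - M 0 0 * M 1 1) * h2

theorem coeff_thetaTrace_of_lt (n : ℕ) : ∀ z : ℤ, n < z → (thetaTrace n).coeff z = 0 := by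
  induction n using Nat.twoStepInduction with
  | zero => simp [thetaTrace_zero]
  | one =>
    intro z hz
    rw [thetaTrace_one, coeff_threeTerm, if_neg (by omega), if_neg (by omega), if_neg (by omega)]
    simp
  | more n h0 h1 =>
    intro z hz
    push_cast at hz h1
    rw [thetaTrace_add_two, AddMonoidAlgebra.coeff_add, Finsupp.add_apply, coeff_threeTerm_mul,
      h1 _ (by omega), h1 _ (by omega), h1 _ (by omega), h0 _ (by omega)]
    simp

theorem coeff_thetaTrace_self (n : ℕ) :
    (thetaTrace (n + 1)).coeff ((n + 1 : ℕ) : ℤ) = 1 := by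
  induction n with
  | zero => simp [thetaTrace_one, coeff_threeTerm]
  | succ n ih =>
    have : ((n + 1 + 1 : ℕ) : ℤ) - 1 = ((n + 1 : ℕ) : ℤ) := by push_cast; ring
    rw [thetaTrace_add_two, AddMonoidAlgebra.coeff_add, Finsupp.add_apply, coeff_threeTerm_mul,
      this, ih, coeff_thetaTrace_of_lt _ _ (by push_cast; omega),
      coeff_thetaTrace_of_lt _ _ (by push_cast; omega),
      coeff_thetaTrace_of_lt _ _ (by push_cast; omega)]
    simp

/-- In the trace recursion each step carries this coefficient over and adds the leading one, which
is 1. -/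
theorem coeff_thetaTrace_sub_one (n : ℕ) :
    (thetaTrace (n + 1)).coeff (n : ℤ) = (n + 1 : ℕ) := by
  induction n with
  | zero => simp [thetaTrace_one, coeff_threeTerm]
  | succ n ih =>
    have : ((n + 1 : ℕ) : ℤ) - 1 = n := by push_cast; ring
    rw [thetaTrace_add_two, AddMonoidAlgebra.coeff_add, Finsupp.add_apply, coeff_threeTerm_mul,
      this, ih, coeff_thetaTrace_self, coeff_thetaTrace_of_lt _ _ (by push_cast; omega),
      coeff_thetaTrace_of_lt _ _ (by push_cast; omega)]
    push_cast
    ring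

theorem thetaTrace_ne (n : ℕ) (hn : 0 < n) (w : ℤ) : thetaTrace n ≠ T w + T (-w) := by
  induction n using Nat.strong_induction_on generalizing w with
  | _ n ih =>
  intro h
  have hc (z : ℤ) : (thetaTrace n).coeff z =
      (if w = z then 1 else 0) + if -w = z then 1 else 0 := by
    rw [h, AddMonoidAlgebra.coeff_add, Finsupp.add_apply, T_apply, T_apply]
  obtain ⟨m, rfl⟩ : ∃ m, n = m + 1 := ⟨n - 1, by omega⟩
  -- The leading coefficient of the trace must be matched by one of the two monomials.
  have hw : w = (m + 1 : ℕ) ∨ -w = (m + 1 : ℕ) := by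
    by_contra hw
    push Not at hw
    have := hc (m + 1 : ℕ)
    rw [coeff_thetaTrace_self, if_neg hw.1, if_neg hw.2] at this
    exact one_ne_zero (this.trans (add_zero 0))
  -- An even exponent makes both sides squares, so the square root is a smaller counterexample; an
  -- odd one leaves a nonzero coefficient just below the top.
  rcases Nat.even_or_odd (m + 1) with ⟨k, hk⟩ | hodd
  · obtain ⟨v, rfl⟩ : ∃ v, w = v * 2 := by
      rcases hw with hw | hw
      · exact ⟨k, by omega⟩
      · exact ⟨-k, by omega⟩
    refine ih k (by omega) (by omega) v (sq_injective ?_)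
    simp only
    rw [← thetaTrace_two_mul, two_mul, ← hk, h, CharTwo.add_sq, T_pow, T_pow]
    push_cast
    congr 2 <;> ring
  · have := hc m
    rw [coeff_thetaTrace_sub_one, if_neg (by omega), if_neg (by omega),
      (ZMod.natCast_eq_one_iff_odd).2 hodd] at this
    exact one_ne_zero (this.trans (add_zero 0))

/-- An eigenvalue λ = u^w would be a root of the characteristic polynomial λ² - λ tr + 1; dividing
by the unit λ gives tr = λ + λ⁻¹. -/
theorem thetaMatrix_pow_mulVec_ne (n : ℕ) (hn : 0 < n) (w : ℤ) (v : Fin 2 → (ZMod 2)[T;T⁻¹])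
    (hv : v ≠ 0) : thetaMatrix ^ n *ᵥ v ≠ (T w : (ZMod 2)[T;T⁻¹]) • v := by
  intro h
  have hdet : (thetaMatrix ^ n - (T w : (ZMod 2)[T;T⁻¹]) • 1).det = 0 := by
    refine exists_mulVec_eq_zero_iff.1 ⟨v, hv, ?_⟩
    rw [sub_mulVec, h, smul_mulVec, one_mulVec, sub_self]
  refine thetaTrace_ne n hn w ?_
  have h1 := det_thetaMatrix_pow n
  have hT : (T w : (ZMod 2)[T;T⁻¹]) * T (-w) = 1 := by rw [← T_add, add_neg_cancel, T_zero]
  rw [thetaTrace, trace_fin_two]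
  rw [det_fin_two] at hdet h1
  simp only [Matrix.sub_apply, Matrix.smul_apply, one_apply_eq, smul_eq_mul, mul_one,
    one_apply_ne (show (0 : Fin 2) ≠ 1 by decide), one_apply_ne (show (1 : Fin 2) ≠ 0 by decide),
    mul_zero, sub_zero] at hdet
  linear_combination (-T (-w)) * hdet + T (-w) * h1 +
    (T w - (thetaMatrix ^ n) 0 0 - (thetaMatrix ^ n) 1 1) * hT

end Algebra

/-! ### Linear automata acting on finitely supported configurations -/

section Linear

open LaurentPolynomial Matrix

variable {R : Type*} [CommRing R] {d : ℕ}

/-- The finitely supported configuration whose generating functions are the `V i`. -/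
def toConfig (V : Fin d → R[T;T⁻¹]) : ℤ → Fin d → R := fun x i => (V i).coeff x

theorem toConfig_T_smul (w : ℤ) (V : Fin d → R[T;T⁻¹]) :
    toConfig ((T w : R[T;T⁻¹]) • V) = (shift _ w).toFun (toConfig V) := by
  funext x i
  have := AddMonoidAlgebra.coeff_single_mul_apply (V i) (1 : R) w x
  rw [one_mul, neg_add_eq_sub] at this
  exact this

theorem toConfig_injective : Function.Injective (toConfig (R := R) (d := d)) := fun _ _ h =>
  funext fun i => LaurentPolynomial.ext fun x => congrFun (congrFun h x) i

theorem exists_toConfig_eq (c : ℤ → Fin d → R) (hc : c.support.Finite) :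
    ∃ V, toConfig V = c :=
  ⟨fun i => AddMonoidAlgebra.ofCoeff (Finsupp.ofSupportFinite (fun x => c x i)
    (hc.subset fun x hx h => hx (by simp only [h, Pi.zero_apply]))), rfl⟩

theorem linear_toConfig (M : Matrix (Fin d) (Fin d) R[T;T⁻¹]) (V : Fin d → R[T;T⁻¹]) :
    (linear M).toFun (toConfig V) = toConfig (M *ᵥ V) := by
  funext x i
  simp only [linear, toConfig, mulVec, dotProduct, AddMonoidAlgebra.coeff_sum,
    Finsupp.finsetSum_apply]
  refine Finset.sum_congr rfl fun j _ => ?_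
  rw [AddMonoidAlgebra.coeff_mul_apply_left]
  simp only [neg_add_eq_sub]

theorem linear_add (M : Matrix (Fin d) (Fin d) R[T;T⁻¹]) (b c : ℤ → Fin d → R) :
    (linear M).toFun (b + c) = (linear M).toFun b + (linear M).toFun c := by
  funext x i
  simp only [linear, Pi.add_apply, mul_add, Finsupp.sum_add, Finset.sum_add_distrib]

theorem iterate_linear_add (M : Matrix (Fin d) (Fin d) R[T;T⁻¹]) (n : ℕ)
    (b c : ℤ → Fin d → R) : ((linear M).iterate n).toFun (b + c) =
      ((linear M).iterate n).toFun b + ((linear M).iterate n).toFun c := by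
  induction n with
  | zero => rfl
  | succ n ih =>
    simp only [iterate, comp] at ih ⊢
    rw [ih, linear_add]

theorem iterate_linear_toConfig (M : Matrix (Fin d) (Fin d) R[T;T⁻¹]) (n : ℕ)
    (V : Fin d → R[T;T⁻¹]) :
    ((linear M).iterate n).toFun (toConfig V) = toConfig (M ^ n *ᵥ V) := by
  induction n with
  | zero => simp [iterate, CellularAutomaton.id]
  | succ n ih =>
    simp only [iterate, comp] at ih ⊢
    rw [ih, linear_toConfig, mulVec_mulVec, ← pow_succ']

/-- By additivity the influence is affine in q, and its linear part is the matrix of coefficients of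
u^x in M^n, whatever c is. -/
theorem influence_linear (M : Matrix (Fin d) (Fin d) R[T;T⁻¹]) (n : ℕ) (x : ℤ)
    (c : ℤ → Fin d → R) (q : Fin d → R) :
    (linear M).influence n x c q = (linear M).influence n x c 0 +
      fun i => ∑ j, ((M ^ n) i j).coeff x * q j := by
  have h : Function.update c 0 q =
      Function.update c 0 0 + toConfig fun i => C (q i) := by
    funext x i
    by_cases hx : x = 0
    · subst hx; simp [toConfig]
    · simp [toConfig, hx]
  rw [influence, h, iterate_linear_add, iterate_linear_toConfig, Pi.add_apply]
  congr 1
  funext i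
  simp only [toConfig, mulVec, dotProduct, AddMonoidAlgebra.coeff_sum, Finsupp.finsetSum_apply]
  refine Finset.sum_congr rfl fun j _ => ?_
  rw [← single_eq_C, AddMonoidAlgebra.coeff_mul_single_zero]

theorem isConcentrated_linear {M : Matrix (Fin d) (Fin d) R[T;T⁻¹]} {a : ℤ} {b l r : ℕ}
    (h : ∀ z : ℤ, a - l ≤ z → z ≤ a + r →
      ∀ i j, ((M ^ b) i j).coeff z = if z = a ∧ i = j then 1 else 0) :
    (linear M).IsConcentrated a b l r := by
  constructor
  · intro c
    have : (linear M).influence b a c = fun q => (linear M).influence b a c 0 + q := by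
      funext q
      rw [influence_linear]
      congr 1
      funext i
      simp only [h a (by omega) (by omega), true_and, ite_mul, one_mul, zero_mul,
        Finset.sum_ite_eq, Finset.mem_univ, if_true]
    rw [this]
    exact (Equiv.addLeft _).bijective
  · intro c z h1 h2 hz q q'
    rw [influence_linear, influence_linear _ _ _ _ q']
    simp [h z h1 h2, hz]

end Linear

/-! ### Concentration of powers of Θ, and points of X_2 -/

section Concentration

open LaurentPolynomial Matrix

theorem Theta_eq : Theta = linear thetaMatrix := rfl

theorem fin_two_congr {α : Type*} {a b c d a' b' c' d' : α} (ha : a = a') (hb : b = b')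
    (hc : c = c') (hd : d = d') : !![a, b; c, d] = !![a', b'; c', d'] := by
  rw [ha, hb, hc, hd]

/-- Near the position `a`, up to the distance `r`, the `b`-th power of the matrix of `Θ` is the
monomial `u^a`. -/
def ConcentratedPow (a : ℤ) (b : ℕ) (r : ℤ) : Prop :=
  ∃ p q : (ZMod 2)[T;T⁻¹], thetaMatrix ^ b = !![p, q; q, p + threeTerm * q] ∧
    (∀ z, |z - a| ≤ r → q.coeff z = 0) ∧
    ∀ z, |z - a| < r → p.coeff z = if z = a then 1 else 0

/-- Squaring leaves only even exponents, so q² vanishes up to distance 2r + 1 from 2a;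
multiplication by s costs one, which leaves exactly 2r. -/
theorem ConcentratedPow.two_mul {a : ℤ} {b : ℕ} {r : ℤ} (h : ConcentratedPow a b r) :
    ConcentratedPow (2 * a) (2 * b) (2 * r) := by
  obtain ⟨p, q, hM, hq, hp⟩ := h
  have h2 : (2 : (ZMod 2)[T;T⁻¹]) = 0 := CharTwo.two_eq_zero
  have hq' (z : ℤ) (hz : |z - 2 * a| ≤ 2 * r + 1) : (q ^ 2).coeff z = 0 := by
    rw [coeff_sq]
    split_ifs with he
    · obtain ⟨y, rfl⟩ := he
      rw [abs_le] at hz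
      exact hq _ (abs_le.2 ⟨by omega, by omega⟩)
    · rfl
  refine ⟨p ^ 2 + q ^ 2, threeTerm * q ^ 2, ?_, fun z hz => ?_, fun z hz => ?_⟩
  · rw [mul_comm, pow_mul, hM, pow_two, mul_fin_two]
    refine fin_two_congr ?_ ?_ ?_ ?_
    · ring
    · linear_combination p * q * h2
    · linear_combination p * q * h2
    · linear_combination threeTerm * q * p * h2
  · rw [abs_le] at hz
    rw [coeff_threeTerm_mul, hq' _ (abs_le.2 ⟨by omega, by omega⟩),
      hq' _ (abs_le.2 ⟨by omega, by omega⟩), hq' _ (abs_le.2 ⟨by omega, by omega⟩)]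
    simp
  · rw [abs_lt] at hz
    rw [AddMonoidAlgebra.coeff_add, Finsupp.add_apply, hq' _ (abs_le.2 ⟨by omega, by omega⟩),
      add_zero, coeff_sq]
    by_cases he : Even z
    · obtain ⟨y, rfl⟩ := he
      rw [if_pos (Even.add_self y), hp _ (abs_lt.2 ⟨by omega, by omega⟩)]
      congr 1
      apply propext
      constructor <;> intro h <;> omega
    · rw [if_neg he, if_neg]
      rintro rfl
      exact he (even_two_mul a)

theorem ConcentratedPow.two_pow_mul {a : ℤ} {b : ℕ} {r : ℤ} (h : ConcentratedPow a b r) (n : ℕ) :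
    ConcentratedPow (2 ^ n * a) (2 ^ n * b) (2 ^ n * r) := by
  induction n with
  | zero => simpa using h
  | succ n ih =>
    simp only [pow_succ', mul_assoc]
    exact ih.two_mul

theorem ConcentratedPow.isConcentrated {a : ℤ} {b : ℕ} {r : ℤ} (h : ConcentratedPow a b r)
    {l : ℕ} (hl : l < r) : Theta.IsConcentrated a b l l := by
  obtain ⟨p, q, hM, hq, hp⟩ := h
  rw [Theta_eq]
  refine isConcentrated_linear fun z h1 h2 i j => ?_
  -- The entry p + s q involves q at z ± 1, hence the strict inequality l < r.
  have hp := hp z (abs_lt.2 ⟨by omega, by omega⟩)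
  have hq0 := hq z (abs_le.2 ⟨by omega, by omega⟩)
  have hq1 := hq (z + 1) (abs_le.2 ⟨by omega, by omega⟩)
  have hq2 := hq (z - 1) (abs_le.2 ⟨by omega, by omega⟩)
  rw [hM]
  fin_cases i <;> fin_cases j <;>
    simp [coeff_threeTerm_mul, hp, hq0, hq1, hq2]

theorem ConcentratedPow.mem_X {a : ℤ} {b : ℕ} (h : ConcentratedPow a b 1) :
    ((a : ℝ), (b : ℝ)) ∈ X 2 Theta := by
  -- After n doublings the radius is 2^n; k = 1 makes the required radius 2^(n-1) strictly smaller.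
  refine ⟨Nat.cast_nonneg b, 1, Filter.eventually_atTop.2 ⟨1, fun n hn => ?_⟩⟩
  refine ⟨2 ^ n * a, 2 ^ n * b, ?_, ?_, (h.two_pow_mul n).isConcentrated ?_⟩
  · push_cast; ring
  · push_cast; ring
  · rw [mul_one]
    exact_mod_cast Nat.pow_lt_pow_right (by norm_num) (by omega)

theorem concentratedPow_zero : ConcentratedPow 0 0 1 := by
  refine ⟨1, 0, ?_, by simp, fun z _ => ?_⟩
  · rw [pow_zero, mul_zero, add_zero, one_fin_two]
  · rw [coeff_one]; simp only [eq_comm]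

theorem thetaMatrix_pow_three :
    thetaMatrix ^ 3 = !![threeTerm, (threeTerm + 1) ^ 2; (threeTerm + 1) ^ 2,
      threeTerm + threeTerm * (threeTerm + 1) ^ 2] := by
  have h2 : (2 : (ZMod 2)[T;T⁻¹]) = 0 := CharTwo.two_eq_zero
  rw [thetaMatrix]
  generalize threeTerm = s
  rw [pow_succ, pow_two, mul_fin_two, mul_fin_two]
  refine fin_two_congr ?_ ?_ ?_ ?_
  · ring
  · linear_combination (-s) * h2
  · linear_combination (-s) * h2
  · linear_combination (-s ^ 2) * h2

theorem thetaMatrix_pow_seven :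
    thetaMatrix ^ 7 = !![threeTerm * ((threeTerm + 1) ^ 2) ^ 2,
      (threeTerm * threeTerm ^ 2 + threeTerm ^ 2 + 1) ^ 2;
      (threeTerm * threeTerm ^ 2 + threeTerm ^ 2 + 1) ^ 2,
      threeTerm * ((threeTerm + 1) ^ 2) ^ 2 +
        threeTerm * (threeTerm * threeTerm ^ 2 + threeTerm ^ 2 + 1) ^ 2] := by
  have h2 : (2 : (ZMod 2)[T;T⁻¹]) = 0 := CharTwo.two_eq_zero
  rw [show 7 = 3 + 3 + 1 from rfl, pow_succ, pow_add, thetaMatrix_pow_three, thetaMatrix]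
  generalize threeTerm = s
  rw [mul_fin_two, mul_fin_two]
  refine fin_two_congr ?_ ?_ ?_ ?_
  · linear_combination (s + 2 * s ^ 2 + s ^ 3) * h2
  · linear_combination (2 * s + 4 * s ^ 2 + 5 * s ^ 3 + 4 * s ^ 4 + s ^ 5) * h2
  · linear_combination (2 * s + 4 * s ^ 2 + 5 * s ^ 3 + 4 * s ^ 4 + s ^ 5) * h2
  · linear_combination (s + 4 * s ^ 2 + 5 * s ^ 3 + 5 * s ^ 4 + 4 * s ^ 5 + s ^ 6) * h2

/-- Here q = (s + 1)² = u⁻² + u², and p = s has constant term 1. -/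
theorem concentratedPow_three : ConcentratedPow 0 3 1 := by
  refine ⟨_, _, thetaMatrix_pow_three, fun z hz => ?_, fun z hz => ?_⟩
  · rw [sub_zero, abs_le] at hz
    obtain ⟨h1, h2⟩ := hz
    interval_cases z <;> simp [coeff_sq, coeff_threeTerm]; decide
  · rw [sub_zero, Int.abs_lt_one_iff] at hz
    subst hz
    simp [coeff_threeTerm]

/-- Since s³ + s² + 1 = u⁻³ + 1 + u³, q = u⁻⁶ + 1 + u⁶ vanishes at 2, 3, 4; and p = s(u⁻⁴ + u⁴) has
coefficient 1 at 3. -/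
theorem concentratedPow_seven : ConcentratedPow 3 7 1 := by
  refine ⟨_, _, thetaMatrix_pow_seven, fun z hz => ?_, fun z hz => ?_⟩
  · rw [abs_le] at hz
    obtain ⟨h1, h2⟩ : 2 ≤ z ∧ z ≤ 4 := by omega
    interval_cases z <;> simp [coeff_sq, coeff_threeTerm, coeff_threeTerm_mul, coeff_one] <;> decide
  · rw [Int.abs_lt_one_iff, sub_eq_zero] at hz
    subst hz
    simp [coeff_sq, coeff_threeTerm, coeff_threeTerm_mul, coeff_one] ; decide

theorem not_collinear_closure_X : ¬ Collinear ℝ (closure (X 2 Theta)) := by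
  intro h
  have h0 : ((0 : ℝ), (0 : ℝ)) ∈ X 2 Theta := by simpa using concentratedPow_zero.mem_X
  have h3 : ((0 : ℝ), (3 : ℝ)) ∈ X 2 Theta := by simpa using concentratedPow_three.mem_X
  have h7 : ((3 : ℝ), (7 : ℝ)) ∈ X 2 Theta := by simpa using concentratedPow_seven.mem_X
  obtain ⟨v, hv⟩ := (collinear_iff_of_mem (subset_closure h0)).1 h
  obtain ⟨r, hr⟩ := hv _ (subset_closure h3)
  obtain ⟨t, ht⟩ := hv _ (subset_closure h7)
  simp only [Prod.ext_iff, vadd_eq_add, Prod.fst_add, Prod.snd_add, Prod.smul_fst, Prod.smul_snd,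
    smul_eq_mul, add_zero] at hr ht
  obtain ⟨hr1, hr2⟩ := hr
  obtain ⟨ht1, ht2⟩ := ht
  -- The equations give 9 = (r v₂)(t v₁) = (r v₁)(t v₂) = 0.
  nlinarith

end Concentration

/-! ### Iterates and shifts -/

theorem iterate_id (n : ℕ) : (CellularAutomaton.id A).iterate n = CellularAutomaton.id A := by
  induction n with
  | zero => rfl
  | succ n ih => rw [iterate, ih]; rfl

theorem toFun_shift (F : CellularAutomaton A) (z : ℤ) (c : ℤ → A) :
    F.toFun ((shift A z).toFun c) = (shift A z).toFun (F.toFun c) := by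
  funext x
  have := F.commute c (-z) x
  simp only [neg_add_eq_sub] at this
  exact this

theorem shift_shift (y z : ℤ) (c : ℤ → A) :
    (shift A y).toFun ((shift A z).toFun c) = (shift A (y + z)).toFun c := by
  funext x
  simp only [shift]
  congr 1
  ring

theorem iterate_add_toFun (F : CellularAutomaton A) (m n : ℕ) (c : ℤ → A) :
    (F.iterate (m + n)).toFun c = (F.iterate m).toFun ((F.iterate n).toFun c) := by
  induction m with
  | zero => rw [zero_add]; rfl
  | succ m ih =>
    rw [Nat.add_right_comm]
    simp only [iterate, comp, ih]

/-! ### Recoding and simulation of the identity -/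

section Simulation

theorem pack_shift {m : ℕ} (hm : 0 < m) (k : ℤ) (c : ℤ → A) :
    pack A m hm ((shift A (m * k)).toFun c) = (shift _ k).toFun (pack A m hm c) := by
  funext z i
  simp only [pack, shift, Equiv.coe_fn_mk]
  congr 1
  ring

theorem pack_symm_shift {m : ℕ} (hm : 0 < m) (k : ℤ) (d : ℤ → Fin m → A) :
    (pack A m hm).symm ((shift _ k).toFun d) =
      (shift A (m * k)).toFun ((pack A m hm).symm d) := by
  rw [Equiv.symm_apply_eq, pack_shift, Equiv.apply_symm_apply]

/-- The map on configurations of unpacked cells which is induced by a map between the states of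
packed cells. -/
def recode {m₁ m₂ : ℕ} (hm₁ : 0 < m₁) (hm₂ : 0 < m₂) (φ : (Fin m₁ → A) → Fin m₂ → B)
    (c : ℤ → A) : ℤ → B :=
  (pack B m₂ hm₂).symm (φ ∘ pack A m₁ hm₁ c)

variable {m₁ m₂ : ℕ} {hm₁ : 0 < m₁} {hm₂ : 0 < m₂} {φ : (Fin m₁ → A) → Fin m₂ → B}

theorem recode_injective (hφ : Function.Injective φ) :
    Function.Injective (recode hm₁ hm₂ φ) :=
  (pack B m₂ hm₂).symm.injective.comp (hφ.comp_left.comp (pack A m₁ hm₁).injective)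

theorem recode_shift (k : ℤ) (c : ℤ → A) :
    recode hm₁ hm₂ φ ((shift A (m₁ * k)).toFun c) =
      (shift B (m₂ * k)).toFun (recode hm₁ hm₂ φ c) := by
  rw [recode, pack_shift, recode, ← pack_symm_shift]
  rfl

/-- Changing cell 0 affects only the packed cell 0, hence only the m₂ unpacked cells 0, …, m₂ - 1.
-/
theorem finite_support_recode_sub [AddGroup B] {c d : ℤ → A} (h : ∀ x, x ≠ 0 → c x = d x) :
    (recode hm₁ hm₂ φ c - recode hm₁ hm₂ φ d).support.Finite := by
  refine (Set.finite_Ico (0 : ℤ) m₂).subset fun x hx => ?_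
  by_contra hx'
  apply hx
  have hne : x / (m₂ : ℤ) ≠ 0 := fun h0 => hx' <| by
    have h1 := Int.emod_nonneg x (b := m₂) (by omega)
    have h2 := Int.emod_lt_of_pos x (b := m₂) (by omega)
    have h3 := Int.mul_ediv_add_emod x m₂
    rw [h0, mul_zero, zero_add] at h3
    exact ⟨h3 ▸ h1, h3 ▸ h2⟩
  have hp : pack A m₁ hm₁ c (x / m₂) = pack A m₁ hm₁ d (x / m₂) := by
    funext i
    refine h _ fun h0 => hne ?_
    have hi : ((i : ℕ) : ℤ) < m₁ := by exact_mod_cast i.2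
    have h1 : ((m₁ : ℤ) * (x / m₂) + (i : ℕ)) / m₁ = x / m₂ := by
      rw [Int.mul_add_ediv_left _ _ (by omega), Int.ediv_eq_zero_of_lt (by omega) hi, add_zero]
    rw [← h1, h0, Int.zero_ediv]
  simp only [Pi.sub_apply, recode, pack, Equiv.coe_fn_symm_mk, Function.comp_apply] at hp ⊢
  simp only [Equiv.coe_fn_mk] at hp ⊢
  rw [hp, sub_self]

/-- An automaton that simulates the identity has an iterate that acts as a shift on the recoded
configurations. -/
theorem exists_iterate_recode {F : CellularAutomaton B}
    (h : F.Simulates (CellularAutomaton.id A)) :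
    ∃ (m₁ m₂ : ℕ) (hm₁ : 0 < m₁) (hm₂ : 0 < m₂) (φ : (Fin m₁ → A) → Fin m₂ → B) (t : ℕ) (w : ℤ),
      Function.Injective φ ∧ 0 < t ∧ ∀ c, (F.iterate t).toFun (recode hm₁ hm₂ φ c) =
        (shift B w).toFun (recode hm₁ hm₂ φ c) := by
  obtain ⟨m₁, m₂, hm₁, hm₂, t₁, t₂, z₁, z₂, -, ht₂, φ, hφ, h⟩ := h
  have hstep (c : ℤ → A) : recode hm₁ hm₂ φ ((shift A z₁).toFun c) =
      (shift B z₂).toFun ((F.iterate t₂).toFun (recode hm₁ hm₂ φ c)) := by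
    have := congrArg (pack B m₂ hm₂).symm (h (pack A m₁ hm₁ c))
    simp only [rescale, group, comp, iterate_id, Equiv.symm_apply_apply] at this
    exact this
  have hn (n : ℕ) (c : ℤ → A) : recode hm₁ hm₂ φ ((shift A (n * z₁)).toFun c) =
      (shift B (n * z₂)).toFun ((F.iterate (n * t₂)).toFun (recode hm₁ hm₂ φ c)) := by
    induction n generalizing c with
    | zero => simp [shift, iterate, CellularAutomaton.id]
    | succ n ih =>
      have h1 (z : ℤ) : ((n + 1 : ℕ) : ℤ) * z = n * z + z := by push_cast; ring
      rw [h1, h1, ← shift_shift, ih, hstep, toFun_shift, shift_shift, Nat.add_one_mul,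
        iterate_add_toFun]
  -- Recoding turns σ_{z₁} into σ_{z₂} F^{t₂}. Its m₁-th power shifts the source by m₁ z₁, a whole
  -- number of blocks, which is a shift by m₂ z₁ on the recoded side.
  refine ⟨m₁, m₂, hm₁, hm₂, φ, m₁ * t₂, m₂ * z₁ - m₁ * z₂, hφ, Nat.mul_pos hm₁ ht₂, fun c => ?_⟩
  have := congrArg (shift B (-(m₁ * z₂))).toFun ((hn m₁ c).symm.trans (recode_shift z₁ c))
  rw [shift_shift, shift_shift, neg_add_cancel, neg_add_eq_sub] at this
  rw [← this]
  simp [shift]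

theorem IsSubautomaton.simulates {F : CellularAutomaton A} {G : CellularAutomaton B}
    (h : F.IsSubautomaton G) : G.Simulates F := by
  obtain ⟨φ, hφ, h⟩ := h
  refine ⟨1, 1, one_pos, one_pos, 1, 1, 0, 0, one_pos, one_pos, fun f => φ ∘ f, hφ.comp_left,
    fun c => ?_⟩
  funext z i
  simp only [rescale, group, comp, shift, iterate, CellularAutomaton.id, pack, Equiv.coe_fn_mk,
    Equiv.coe_fn_symm_mk, Function.comp_apply]
  exact congrFun (h _) _

end Simulation

/-! ### The simulations of Θ -/

section Theta

open LaurentPolynomial Matrix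

theorem not_Theta_simulates_id (A : Type*) [Nontrivial A] :
    ¬ Theta.Simulates (CellularAutomaton.id A) := by
  intro h
  obtain ⟨m₁, m₂, hm₁, hm₂, φ, t, w, hφ, ht, h⟩ := exists_iterate_recode h
  obtain ⟨a, b, hab⟩ := exists_pair_ne A
  set c : ℤ → A := fun _ => a
  set d : ℤ → A := Function.update c 0 b
  have hcd : d ≠ c := fun h => hab (by simpa [c, d] using (congrFun h 0).symm)
  obtain ⟨V, hV⟩ := exists_toConfig_eq (recode hm₁ hm₂ φ d - recode hm₁ hm₂ φ c)
    (finite_support_recode_sub fun x hx => by simp [d, hx])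
  have hV' : recode hm₁ hm₂ φ d = toConfig V + recode hm₁ hm₂ φ c := by
    rw [hV, sub_add_cancel]
  refine thetaMatrix_pow_mulVec_ne t ht w V ?_ (toConfig_injective ?_)
  · rintro rfl
    refine hcd (recode_injective hφ (a₁ := d) (a₂ := c) (hm₁ := hm₁) (hm₂ := hm₂) ?_)
    rw [hV']
    funext x i
    simp [toConfig]
  · have hd := h d
    rw [hV', Theta_eq, iterate_linear_add, ← Theta_eq, h c, Theta_eq,
      iterate_linear_toConfig] at hd
    rw [toConfig_T_smul]
    exact add_right_cancel hd

/-- The inverse of `Θ`. -/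
noncomputable def thetaInv : CellularAutomaton (Fin 2 → ZMod 2) :=
  linear !![threeTerm, 1; 1, 0]

theorem sum_coeff_threeTerm (f : ℤ → ZMod 2) :
    (threeTerm.coeff.sum fun k a => a * f k) = f (-1) + f 0 + f 1 := by
  have h : threeTerm.coeff = Finsupp.single (-1) 1 + Finsupp.single 0 1 + Finsupp.single 1 1 := rfl
  rw [h, Finsupp.sum_add_index', Finsupp.sum_add_index'] <;> simp [add_mul]

theorem sum_coeff_one (f : ℤ → ZMod 2) :
    ((1 : (ZMod 2)[T;T⁻¹]).coeff.sum fun k a => a * f k) = f 0 := by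
  have h : (1 : (ZMod 2)[T;T⁻¹]).coeff = Finsupp.single 0 1 := rfl
  rw [h]
  simp

theorem Theta_toFun (c : ℤ → Fin 2 → ZMod 2) (x : ℤ) :
    Theta.toFun c x = ![c x 1, c x 0 + (c (x + 1) 1 + c x 1 + c (x - 1) 1)] := by
  rw [Theta_eq]
  funext i
  fin_cases i <;>
    simp [linear, thetaMatrix, Fin.sum_univ_two, sum_coeff_one fun k => c (x - k) _,
      sum_coeff_threeTerm fun k => c (x - k) _]

theorem thetaInv_toFun (c : ℤ → Fin 2 → ZMod 2) (x : ℤ) :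
    thetaInv.toFun c x = ![c (x + 1) 0 + c x 0 + c (x - 1) 0 + c x 1, c x 0] := by
  rw [thetaInv]
  funext i
  fin_cases i <;>
    simp [linear, Fin.sum_univ_two, sum_coeff_one fun k => c (x - k) _,
      sum_coeff_threeTerm fun k => c (x - k) _]

theorem thetaInv_comp_Theta : thetaInv.comp Theta = CellularAutomaton.id _ := by
  ext c x i
  simp only [comp, CellularAutomaton.id, thetaInv_toFun, Theta_toFun]
  fin_cases i
  · simp only [Fin.zero_eta, cons_val_zero, cons_val_one]
    linear_combination (c (x + 1) 1 + c x 1 + c (x - 1) 1) * (CharTwo.two_eq_zero (R := ZMod 2))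
  · simp

theorem Theta_comp_thetaInv : Theta.comp thetaInv = CellularAutomaton.id _ := by
  ext c x i
  simp only [comp, CellularAutomaton.id, thetaInv_toFun, Theta_toFun]
  fin_cases i
  · simp
  · simp only [Fin.mk_one, cons_val_zero, cons_val_one]
    linear_combination (c (x + 1) 0 + c x 0 + c (x - 1) 0) * (CharTwo.two_eq_zero (R := ZMod 2))

theorem isReversible_Theta : Theta.IsReversible :=
  ⟨thetaInv, thetaInv_comp_Theta, Theta_comp_thetaInv⟩

/-- `inverse` is an arbitrary choice, but a left inverse equals any right inverse. -/
theorem inverse_eq {F G : CellularAutomaton A} (h : F.IsReversible)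
    (hG : F.comp G = CellularAutomaton.id A) : F.inverse h = G := by
  ext c : 2
  have h1 := congrArg (fun H => H.toFun (G.toFun c)) h.choose_spec.1
  have h2 : F.toFun (G.toFun c) = c := congrArg (fun H => H.toFun c) hG
  simp only [comp, h2] at h1
  exact h1

theorem mirror_Theta : Theta.mirror = Theta := by
  ext c x : 3
  simp only [mirror, Theta_toFun]
  rw [neg_neg, show -(-x + 1) = x - 1 by ring, show -(-x - 1) = x + 1 by ring]
  congr 3
  ring

theorem mirror_thetaInv : thetaInv.mirror = thetaInv := by
  ext c x : 3
  simp only [mirror, thetaInv_toFun]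
  rw [neg_neg, show -(-x + 1) = x - 1 by ring, show -(-x - 1) = x + 1 by ring]
  congr 2
  ring

/-- Exchanging the two coordinates conjugates one matrix to the other. -/
theorem Theta_simulates_thetaInv : Theta.Simulates thetaInv := by
  refine IsSubautomaton.simulates ⟨fun q => ![q 1, q 0], fun p q h => ?_, fun c => ?_⟩
  · funext i
    fin_cases i
    · exact congrFun h 1
    · exact congrFun h 0
  · funext x
    simp only [Function.comp_apply, Theta_toFun, thetaInv_toFun, cons_val_zero, cons_val_one]
    rw [add_comm (c x 1)]

end Theta

end CellularAutomaton

theorem mainTheorem3 :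
    (∃ h : CellularAutomaton.Theta.IsReversible,
      CellularAutomaton.Theta.Simulates CellularAutomaton.Theta.mirror ∧
      CellularAutomaton.Theta.Simulates (CellularAutomaton.Theta.inverse h) ∧
      CellularAutomaton.Theta.Simulates (CellularAutomaton.Theta.dual h)) ∧
    (∀ (A : Type*) [Finite A] [Nontrivial A],
      ¬ CellularAutomaton.Theta.Simulates (CellularAutomaton.id A)) ∧
    ¬ Collinear ℝ (closure (CellularAutomaton.X 2 CellularAutomaton.Theta)) := by
  have hinv := CellularAutomaton.inverse_eq CellularAutomaton.isReversible_Theta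
    CellularAutomaton.Theta_comp_thetaInv
  refine ⟨⟨CellularAutomaton.isReversible_Theta, ?_, ?_, ?_⟩,
    fun A _ _ => CellularAutomaton.not_Theta_simulates_id A,
    CellularAutomaton.not_collinear_closure_X⟩
  · rw [CellularAutomaton.mirror_Theta]
    exact CellularAutomaton.IsSubautomaton.simulates ⟨id, Function.injective_id, fun _ => rfl⟩
  · rw [hinv]
    exact CellularAutomaton.Theta_simulates_thetaInv
  · rw [CellularAutomaton.dual, hinv, CellularAutomaton.mirror_thetaInv]
    exact CellularAutomaton.Theta_simulates_thetaInv
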